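/- A standard space is a locally compact separable metrizable topological space. Let $Y$ be a standard space, $X$ a Hausdorff space and $q:Y\to X$ a quotient map. Let $Y_*$ be the set of non-empty closed subsets of $Y$ that lie in the closure of the set of fibres $\{q^{-1}(x):x\in X\}$ with respect to the Fell topology on the closed subsets of $Y$ (the topology generated by the sets $\{F: F\cap K=\emptyset\}$, $K\subseteq Y$ compact, and $\{F: F\cap U\neq\emptyset\}$, $U\subseteq Y$ open). Each $F\in Y_*$ is contained in a single fibre of $q$; let $q_*:Y_*\to X$ be the map with $q_*(F)=q(y)$ for $y\in F$. Call a subset $A\subseteq X$ sequentially dense if every point of $X$ is the limit of a sequence of points of $A$. Let $L$ be the set of points of $X$ that have a compact neighbourhood, and suppose that $L$ is sequentially dense in $X$. Let $E$ be the set of those $x\in L$ for which $q_*^{-1}(x)$ is a singleton. For $x_0\in X$, say that condition (b) holds at $x_0$ if, whenever $(x_m)$ is a sequence of distinct points of $X$ with limit $x_0$, there are a subsequence $(x_n)$ and, for each $n$, a sequence $(x_n^j)_{j}$ in $E$ with $x_n^j\to x_n$ as $j\to\infty$, such that every diagonal sequence $(x_n^{j_n})_{n}$ (with arbitrary indices $j_n$)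 converges to $x_0$. Then the following are equivalent: (i) there are a standard space $Z$ and a quotient map $p:Z\to X$ that is irreducible, i.e. no proper closed subset $V$ of $Z$ satisfies $p(V)=X$; (ii) $E$ is sequentially dense in $X$ and has property (b), i.e. condition (b) holds at every $x_0\in X$; (iii) condition (b) holds at every $x_0\in X\setminus L$. -/

import Mathlib

open Set Filter Topology TopologicalSpace

universe w u v

/-- A standard space: a locally compact separable metrizable space. -/
def IsStandardSpace (Y : Type*) [TopologicalSpace Y] : Prop :=
  LocallyCompactSpace Y ∧ SeparableSpace Y ∧ MetrizableSpace Y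

/-- A surjective map is irreducible if no proper closed subset of its domain is mapped onto
its codomain. -/
def IsIrreducibleMap {Y X : Type*} [TopologicalSpace Y] (q : Y → X) : Prop :=
  Function.Surjective q ∧ ∀ V : Set Y, IsClosed V → q '' V = univ → V = univ

/-- `X` is the image of a standard space under an irreducible quotient map. -/
def IsIrreducibleQuotientOfStandard.{a, b} (X : Type b) [TopologicalSpace X] : Prop :=
  ∃ (Z : Type a) (_ : TopologicalSpace Z) (p : Z → X),
    IsStandardSpace Z ∧ IsQuotientMap p ∧ IsIrreducibleMap p

/-- The Fell topology on the closed subsets of `Y`: it is generated by the sets of all `F` missing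
a given compact set, and the sets of all `F` meeting a given open set. -/
abbrev fellTopology (Y : Type*) [TopologicalSpace Y] : TopologicalSpace (Closeds Y) :=
  generateFrom
    ({S | ∃ K : Set Y, IsCompact K ∧ S = {F : Closeds Y | (F : Set Y) ∩ K = ∅}} ∪
     {S | ∃ U : Set Y, IsOpen U ∧ S = {F : Closeds Y | ((F : Set Y) ∩ U).Nonempty}})

/-- The set of those closed subsets of `Y` that are fibres of `q`. -/
def fibres {Y X : Type*} [TopologicalSpace Y] (q : Y → X) : Set (Closeds Y) :=
  {F | ∃ x : X, (F : Set Y) = q ⁻¹' {x}}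

/-- The space `Y_*`: the nonempty closed subsets of `Y` in the Fell closure of the set of
fibres of `q`. -/
def YStar {Y X : Type*} [TopologicalSpace Y] (q : Y → X) : Set (Closeds Y) :=
  {F | (F : Set Y).Nonempty ∧ F ∈ closure[fellTopology Y] (fibres q)}

/-- The map `q_*` from `Y_*` to `X`, sending `F` to the value of `q` at a point of `F`
(see `qStar_eq` for the independence of the point). -/
noncomputable def qStar {Y X : Type*} [TopologicalSpace Y] (q : Y → X) (F : YStar q) : X :=
  q F.2.1.some

/-- If `X` is Hausdorff and `q` is continuous, then `q` is constant on each member of `Y_*`. -/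
theorem qStar_eq {Y X : Type*} [TopologicalSpace Y] [TopologicalSpace X] [T2Space X]
    {q : Y → X} (hq : Continuous q) (F : YStar q) {y : Y} (hy : y ∈ F.1) :
    qStar q F = q y := by
  by_contra hne
  obtain ⟨U, V, hU, hV, hxU, hyV, hUV⟩ := t2_separation hne
  have hopen : ∀ W : Set X, IsOpen W →
      IsOpen[fellTopology Y] {G : Closeds Y | ((G : Set Y) ∩ q ⁻¹' W).Nonempty} := fun W hW =>
    isOpen_generateFrom_of_mem (Or.inr ⟨_, hW.preimage hq, rfl⟩)
  let _ := fellTopology Y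
  obtain ⟨G, ⟨hGU, hGV⟩, x, hG⟩ := mem_closure_iff.1 F.2.2 _ ((hopen U hU).inter (hopen V hV))
    ⟨⟨_, F.2.1.some_mem, hxU⟩, ⟨y, hy, hyV⟩⟩
  obtain ⟨a, ha, haU⟩ := hGU
  obtain ⟨b, hb, hbV⟩ := hGV
  rw [hG] at ha hb
  have ha' : q a = x := ha
  have hb' : q b = x := hb
  exact Set.disjoint_left.1 hUV (show q a ∈ U from haU) (by rw [ha', ← hb']; exact hbV)

/-- The set `L` of points of `X` with a compact neighbourhood. -/
def pointsOfLocalCompactness (X : Type*) [TopologicalSpace X] : Set X :=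
  {x | ∃ K ∈ 𝓝 x, IsCompact K}

/-- The set `E` of points of `L` whose inverse image under `q_*` is a singleton. -/
def singletonPoints {Y X : Type*} [TopologicalSpace Y] [TopologicalSpace X] (q : Y → X) : Set X :=
  {x | x ∈ pointsOfLocalCompactness X ∧ ∃ F : YStar q, qStar q ⁻¹' {x} = {F}}

/-- Every point of `X` is the limit of a sequence of points of `E`. -/
def SequentiallyDense {X : Type*} [TopologicalSpace X] (E : Set X) : Prop :=
  seqClosure E = univ

/-- The diagonal-sequence condition for `E` at the point `x₀`. A diagonal sequence of a double
sequence takes one arbitrary term from each row. -/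
def DiagonalConditionAt {X : Type*} [TopologicalSpace X] (E : Set X) (x₀ : X) : Prop :=
  ∀ x : ℕ → X, Function.Injective x → Tendsto x atTop (𝓝 x₀) →
    ∃ φ : ℕ → ℕ, StrictMono φ ∧ ∃ z : ℕ → ℕ → X,
      (∀ n j, z n j ∈ E) ∧
      (∀ n, Tendsto (z n) atTop (𝓝 (x (φ n)))) ∧
      ∀ j : ℕ → ℕ, Tendsto (fun n => z n (j n)) atTop (𝓝 x₀)

/-- Property (b): the diagonal-sequence condition holds at every point. -/
def PropertyB {X : Type*} [TopologicalSpace X] (E : Set X) : Prop :=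
  ∀ x₀ : X, DiagonalConditionAt E x₀

/-! Two facts about a quotient map from a standard space drive the proof: a convergent sequence lies
in the image of one compact set, and points of `L` have countable neighbourhood bases. (i) ⇒ (iii):
if `p : Z → X` is irreducible, every non-empty open subset of `Z` contains a fibre, so `p ⁻¹' E` is
dense. Lift a convergent sequence into a compact set, pass to a convergent subsequence of lifts, and
approximate its terms ever more closely from `p ⁻¹' E`; the images are the required double sequence
(`diagonalConditionAt_of_dense_preimage`). (iii) ⇒ (ii): by Baire, `E` is dense in `L`, since `q_*`
is injective over points off the frontiers of countably many compact images (`mem_singletonPoints`).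
First countability then gives (b) on `L`. (ii) ⇒ (i): take for `Z` the non-empty sets in the Fell
closure of the fibres over `E`, with `q_*` restricted to it. Irreducibility holds because the fibres
over `E` are dense in `Z` and each is the only point over its value; (b) makes the map a quotient
map (`isQuotientMap_singletonFibreMap`). -/

namespace IsStandardSpace

variable {Y : Type*} [TopologicalSpace Y]

theorem secondCountableTopology (hY : IsStandardSpace Y) : SecondCountableTopology Y := by
  obtain ⟨_, _, _⟩ := hY
  let _ := metrizableSpaceMetric Y
  exact UniformSpace.secondCountable_of_separable Y

theorem t2Space (hY : IsStandardSpace Y) : T2Space Y := by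
  obtain ⟨_, _, _⟩ := hY
  infer_instance

theorem of_homeomorph {Z : Type*} [TopologicalSpace Z] (hY : IsStandardSpace Y) (e : Y ≃ₜ Z) :
    IsStandardSpace Z := by
  obtain ⟨_, _, _⟩ := hY
  exact ⟨e.symm.isClosedEmbedding.locallyCompactSpace,
    e.surjective.denseRange.separableSpace e.continuous,
    e.symm.isEmbedding.metrizableSpace⟩

end IsStandardSpace

/-- A second countable `T₀` space has at most continuum many points. -/
theorem small_of_secondCountableTopology (Z : Type*) [TopologicalSpace Z] [T0Space Z]
    [SecondCountableTopology Z] : Small.{w} Z := by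
  have := (countable_countableBasis Z).to_subtype
  refine small_of_injective (β := Set (countableBasis Z)) (f := fun z => {s | z ∈ s.1})
    fun a b hab => ?_
  exact ((isBasis_countableBasis Z).inseparable_iff.2 fun s hs =>
    Set.ext_iff.1 hab ⟨s, hs⟩).eq

/-- The hyperspace construction yields a space in the universe of `Y`; standard spaces are small, so
the universe is immaterial. -/
theorem IsIrreducibleQuotientOfStandard.change_universe.{a, b, c} {X : Type c}
    [TopologicalSpace X] (h : IsIrreducibleQuotientOfStandard.{a} X) :
    IsIrreducibleQuotientOfStandard.{b} X := by
  obtain ⟨Z, _, p, hZ, hp, hirr⟩ := h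
  have := hZ.secondCountableTopology
  have := hZ.t2Space
  have := small_of_secondCountableTopology.{b} Z
  let e := Shrink.homeomorph.{b} Z
  refine ⟨Shrink.{b} Z, inferInstance, p ∘ e.symm, hZ.of_homeomorph e,
    hp.comp e.symm.isQuotientMap, hirr.1.comp e.symm.surjective, fun V hV hpV => ?_⟩
  have := hirr.2 (e.symm '' V) (e.symm.isClosedMap V hV) (by rw [← image_comp, hpV])
  rw [← image_univ_of_surjective e.symm.surjective] at this
  exact e.symm.injective.image_injective this

/-- A sequence avoiding its limit has an injective subsequence. -/
theorem Filter.Tendsto.exists_injective_subseq {X : Type*} [TopologicalSpace X] [T1Space X]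
    {u : ℕ → X} {x : X} (hu : Tendsto u atTop (𝓝 x)) (hne : ∀ n, u n ≠ x) :
    ∃ φ : ℕ → ℕ, StrictMono φ ∧ Function.Injective (u ∘ φ) := by
  have h : ∀ n, ∃ N > n, ∀ m ≥ N, ∀ i ≤ n, u m ≠ u i := fun n => by
    have : ∀ᶠ m in atTop, n < m ∧ ∀ i ∈ Iic n, u m ≠ u i :=
      (eventually_gt_atTop n).and <| ((finite_Iic n).eventually_all).2 fun i _ =>
        hu.eventually (isOpen_ne.mem_nhds (hne i).symm)
    obtain ⟨N, hN⟩ := eventually_atTop.1 this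
    exact ⟨N, (hN N le_rfl).1, fun m hm => (hN m hm).2⟩
  choose N hgt hN using h
  let φ : ℕ → ℕ := fun n => N^[n] 0
  have hsucc : ∀ n, φ (n + 1) = N (φ n) := fun n => Function.iterate_succ_apply' N n 0
  have hφ : StrictMono φ := strictMono_nat_of_lt_succ fun n => by rw [hsucc]; exact hgt _
  refine ⟨φ, hφ, Function.Injective.of_lt_imp_ne fun i j hij => ?_⟩
  obtain ⟨j, rfl⟩ : ∃ k, j = k + 1 := ⟨j - 1, by omega⟩
  exact (hN (φ j) (φ (j + 1)) (hsucc j).ge (φ i) (hφ.monotone (by omega))).symm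

/-- A compact subset of an open set is covered by finitely many members, contained in the open
set, of any family of sets containing arbitrarily small neighbourhoods of each point. -/
theorem IsCompact.exists_finite_subset_sUnion {Y : Type*} [TopologicalSpace Y] {B : Set (Set Y)}
    (hB : ∀ y, ∀ O ∈ 𝓝 y, ∃ C ∈ B, C ∈ 𝓝 y ∧ C ⊆ O) {D O : Set Y} (hD : IsCompact D)
    (hO : IsOpen O) (hDO : D ⊆ O) :
    ∃ S ⊆ B, S.Finite ∧ D ⊆ ⋃₀ S ∧ ⋃₀ S ⊆ O := by
  choose! C hCB hCn hCO using fun y (hy : y ∈ D) => hB y O (hO.mem_nhds (hDO hy))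
  obtain ⟨t, htD, ht⟩ := hD.elim_nhds_subcover C hCn
  refine ⟨C '' t, ?_, t.finite_toSet.image C, ?_, ?_⟩
  · rintro _ ⟨y, hy, rfl⟩
    exact hCB y (htD y hy)
  · simpa [sUnion_image] using ht
  · rintro z ⟨_, ⟨y, hy, rfl⟩, hz⟩
    exact hCO y (htD y hy) hz

theorem exists_countable_isCompact_nhds (Y : Type*) [TopologicalSpace Y] [T2Space Y]
    [LocallyCompactSpace Y] [SecondCountableTopology Y] :
    ∃ B : Set (Set Y), B.Countable ∧ (∀ C ∈ B, IsCompact C) ∧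
      ∀ y, ∀ O ∈ 𝓝 y, ∃ C ∈ B, C ∈ 𝓝 y ∧ C ⊆ O := by
  refine ⟨{C | C ∈ closure '' countableBasis Y ∧ IsCompact C},
    ((countable_countableBasis Y).image _).mono fun C hC => hC.1, fun C hC => hC.2,
    fun y O hO => ?_⟩
  obtain ⟨N, hN, hNO, hNc⟩ := local_compact_nhds hO
  obtain ⟨V, hV, hyV, hVN⟩ := (isBasis_countableBasis Y).mem_nhds_iff.1 hN
  have hcl : closure V ⊆ N := closure_minimal hVN hNc.isClosed
  exact ⟨closure V, ⟨⟨V, hV, rfl⟩, hNc.of_isClosed_subset isClosed_closure hcl⟩,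
    mem_of_superset (((isBasis_countableBasis Y).isOpen hV).mem_nhds hyV) subset_closure,
    hcl.trans hNO⟩

/-! ### Compact sets and convergent sequences in quotients -/

section CompactExhaustion

variable {Y X : Type*} [TopologicalSpace Y] [TopologicalSpace X] {q : Y → X}

/-- A compact subset of a quotient is contained in the image of a member of a compact
exhaustion. -/
theorem Topology.IsQuotientMap.exists_subset_image [T1Space X] (hq : IsQuotientMap q)
    (K : CompactExhaustion Y) {C : Set X} (hC : IsCompact C) : ∃ k, C ⊆ q '' K k := by
  by_contra! h
  choose x hxC hx using fun k => not_subset.1 (h k)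
  have hcl : ∀ n, IsClosed (x '' Ici n) := fun n => by
    rw [← hq.isClosed_preimage]
    -- The fibres over the `x j` are locally finite: `K m` meets the one over `x j` only if `j < m`.
    have : q ⁻¹' (x '' Ici n) = ⋃ j : Ici n, q ⁻¹' {x j} := by
      ext y
      simp [eq_comm]
    rw [this]
    refine LocallyFinite.isClosed_iUnion (fun y => ?_)
      fun j => isClosed_singleton.preimage hq.continuous
    obtain ⟨m, hm⟩ := K.exists_mem_nhds y
    refine ⟨K m, hm, ((finite_Iio m).preimage Subtype.val_injective.injOn).subset ?_⟩
    rintro j ⟨z, hz, hzm⟩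
    by_contra hj
    exact hx j ⟨z, K.subset (not_lt.1 hj) hzm, hz⟩
  obtain ⟨n, hn⟩ := hC.elim_directed_cover (fun n => (x '' Ici n)ᶜ)
    (fun n => (hcl n).isOpen_compl)
    (fun z _ => by
      obtain ⟨y, rfl⟩ := hq.surjective z
      obtain ⟨m, hm⟩ := K.exists_mem y
      refine mem_iUnion.2 ⟨m, ?_⟩
      rintro ⟨j, hj, hxj⟩
      exact hx j ⟨y, K.subset hj hm, hxj.symm⟩)
    (Monotone.directed_le fun i j hij => compl_subset_compl.2 (image_mono (Ici_subset_Ici.2 hij)))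
  exact hn (hxC n) ⟨n, mem_Ici.2 le_rfl, rfl⟩

theorem Topology.IsQuotientMap.exists_forall_mem_image [T1Space X] (hq : IsQuotientMap q)
    (K : CompactExhaustion Y) {u : ℕ → X} {x : X} (hu : Tendsto u atTop (𝓝 x)) :
    ∃ k, ∀ n, u n ∈ q '' K k := by
  obtain ⟨k, hk⟩ := hq.exists_subset_image K hu.isCompact_insert_range
  exact ⟨k, fun n => hk (mem_insert_of_mem _ ⟨n, rfl⟩)⟩

/-- Some `q '' K k` is a compact neighbourhood of `x`. Removing `q '' (K k \ U)`, for `U` a finite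
union of basic open sets covering the compact set `q ⁻¹' {x} ∩ K k`, gives a countable base. -/
theorem Topology.IsQuotientMap.isCountablyGenerated_nhds [T2Space X] [SecondCountableTopology Y]
    (hq : IsQuotientMap q) (K : CompactExhaustion Y) {x : X}
    (hx : x ∈ pointsOfLocalCompactness X) : (𝓝 x).IsCountablyGenerated := by
  obtain ⟨C, hCx, hC⟩ := hx
  obtain ⟨k, hk⟩ := hq.exists_subset_image K hC
  have hkx : q '' K k ∈ 𝓝 x := mem_of_superset hCx hk
  have hB := isBasis_countableBasis Y
  refine HasCountableBasis.isCountablyGenerated (ι := Set (Set Y))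
    (p := fun S => (S.Finite ∧ S ⊆ countableBasis Y) ∧ q ⁻¹' {x} ∩ K k ⊆ ⋃₀ S)
    (s := fun S => q '' K k \ q '' (K k \ ⋃₀ S)) ⟨⟨fun t => ⟨fun ht => ?_, ?_⟩⟩,
      (countable_ofPred_finite_subset (countable_countableBasis Y)).mono fun S hS => hS.1⟩
  · obtain ⟨S, hSB, hSf, hDS, hSO⟩ :=
      ((K.isCompact k).inter_left (isClosed_singleton.preimage hq.continuous)
        : IsCompact (q ⁻¹' {x} ∩ K k)).exists_finite_subset_sUnion (B := countableBasis Y)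
        (fun y O hO => by
          obtain ⟨V, hV, hyV, hVO⟩ := hB.mem_nhds_iff.1 hO
          exact ⟨V, hV, (hB.isOpen hV).mem_nhds hyV, hVO⟩)
        (isOpen_interior.preimage hq.continuous) (O := q ⁻¹' interior t) (by
          rintro y ⟨rfl, -⟩
          exact mem_interior_iff_mem_nhds.2 ht)
    refine ⟨S, ⟨⟨hSf, hSB⟩, hDS⟩, ?_⟩
    rintro _ ⟨⟨y, hy, rfl⟩, hn⟩
    have : y ∈ ⋃₀ S := by
      by_contra hyS
      exact hn ⟨y, ⟨hy, hyS⟩, rfl⟩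
    exact interior_subset (hSO this)
  · rintro ⟨S, ⟨⟨-, hSB⟩, hDS⟩, hSt⟩
    have hcl : IsClosed (q '' (K k \ ⋃₀ S)) :=
      (((K.isCompact k).diff (isOpen_sUnion fun V hV => hB.isOpen (hSB hV))).image
        hq.continuous).isClosed
    refine mem_of_superset (inter_mem hkx (hcl.isOpen_compl.mem_nhds ?_)) hSt
    rintro ⟨y, ⟨hy, hyS⟩, hyx⟩
    exact hyS (hDS ⟨hyx, hy⟩)

/-- Every open set containing the fibre over a sequential limit of points of `A` meets the
preimage of `A`. -/
theorem Topology.IsQuotientMap.nonempty_inter_preimage [T2Space X] (hq : IsQuotientMap q)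
    (K : CompactExhaustion Y) {U : Set Y} (hU : IsOpen U) {x : X} (hxU : q ⁻¹' {x} ⊆ U)
    {A : Set X} (hx : x ∈ seqClosure A) : (U ∩ q ⁻¹' A).Nonempty := by
  obtain ⟨u, huA, hu⟩ := hx
  obtain ⟨k, hk⟩ := hq.exists_forall_mem_image K hu
  have hcl : IsClosed (q '' (K k \ U)) :=
    (((K.isCompact k).diff hU).image hq.continuous).isClosed
  have hxn : x ∉ q '' (K k \ U) := by
    rintro ⟨y, ⟨-, hy⟩, hyx⟩
    exact hy (hxU hyx)
  obtain ⟨n, hn⟩ := (hu.eventually (hcl.isOpen_compl.mem_nhds hxn)).exists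
  obtain ⟨y, hy, hyn⟩ := hk n
  refine ⟨y, ?_, ?_⟩
  · by_contra hyU
    exact hn ⟨y, ⟨hy, hyU⟩, hyn⟩
  · rw [mem_preimage, hyn]
    exact huA n

end CompactExhaustion

theorem IsIrreducibleMap.exists_fibre_subset {Z X : Type*} [TopologicalSpace Z] {p : Z → X}
    (hp : IsIrreducibleMap p) {U : Set Z} (hU : IsOpen U) (hne : U.Nonempty) :
    ∃ x, p ⁻¹' {x} ⊆ U := by
  by_contra! h
  have := hp.2 Uᶜ hU.isClosed_compl (eq_univ_of_forall fun x => by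
    obtain ⟨y, hy, hyU⟩ := not_subset.1 (h x)
    exact ⟨y, hyU, hy⟩)
  obtain ⟨z, hz⟩ := hne
  exact (this ▸ mem_univ z : z ∈ Uᶜ) hz

/-! ### Baire category at points of local compactness -/

section LocallyCompactPoints

variable {X : Type*} [TopologicalSpace X]

theorem isOpen_pointsOfLocalCompactness : IsOpen (pointsOfLocalCompactness X) := by
  rw [isOpen_iff_mem_nhds]
  rintro x ⟨K, hK, hKc⟩
  exact mem_of_superset (interior_mem_nhds.2 hK) fun y hy =>
    ⟨K, mem_interior_iff_mem_nhds.1 hy, hKc⟩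

instance weaklyLocallyCompactSpace_pointsOfLocalCompactness [T2Space X] :
    WeaklyLocallyCompactSpace (pointsOfLocalCompactness X) where
  exists_compact_mem_nhds x := by
    obtain ⟨K, hK, hKc⟩ := x.2
    obtain ⟨C, ⟨hCx, hC, -⟩, hCL⟩ := (hKc.isCompact_isClosed_basis_nhds hK).mem_iff.1
      (isOpen_pointsOfLocalCompactness.mem_nhds x.2)
    exact ⟨Subtype.val ⁻¹' C, (IsInducing.subtypeVal.isCompact_preimage_iff
      (by rwa [Subtype.range_val])).2 hC, continuous_subtype_val.continuousAt hCx⟩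

/-- A countable family of nowhere dense closed sets has dense common complement in the set of
points of local compactness. -/
theorem pointsOfLocalCompactness_subset_closure [T2Space X] {S : Set (Set X)} (hS : S.Countable)
    (hcl : ∀ C ∈ S, IsClosed C) (hint : ∀ C ∈ S, interior C = ∅) :
    pointsOfLocalCompactness X ⊆
      closure {x | x ∈ pointsOfLocalCompactness X ∧ ∀ C ∈ S, x ∉ C} := by
  intro x hx
  have hd : Dense (⋂ C ∈ S, (Subtype.val ⁻¹' Cᶜ : Set (pointsOfLocalCompactness X))) :=
    dense_biInter_of_isOpen (fun C hC => (hcl C hC).isOpen_compl.preimage continuous_subtype_val)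
      hS fun C hC => (interior_eq_empty_iff_dense_compl.1 (hint C hC)).preimage
        isOpen_pointsOfLocalCompactness.isOpenMap_subtype_val
  have := image_closure_subset_closure_image continuous_subtype_val
    (mem_image_of_mem Subtype.val (hd ⟨x, hx⟩))
  refine closure_mono ?_ this
  rintro _ ⟨y, hy, rfl⟩
  exact ⟨y.2, fun C hC => mem_iInter₂.1 hy C hC⟩

end LocallyCompactPoints

/-! ### The Fell hyperspace and the restriction of `q_*` -/

section FellTopology

variable {Y : Type*} [TopologicalSpace Y]

attribute [local instance] fellTopology

theorem isOpen_fell_inter_eq_empty {K : Set Y} (hK : IsCompact K) :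
    IsOpen {F : Closeds Y | (F : Set Y) ∩ K = ∅} :=
  isOpen_generateFrom_of_mem (Or.inl ⟨K, hK, rfl⟩)

theorem isOpen_fell_inter_nonempty {U : Set Y} (hU : IsOpen U) :
    IsOpen {F : Closeds Y | ((F : Set Y) ∩ U).Nonempty} :=
  isOpen_generateFrom_of_mem (Or.inr ⟨U, hU, rfl⟩)

theorem isClosed_fell_inter_nonempty {K : Set Y} (hK : IsCompact K) :
    IsClosed {F : Closeds Y | ((F : Set Y) ∩ K).Nonempty} := by
  rw [← isOpen_compl_iff]
  convert isOpen_fell_inter_eq_empty hK using 1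
  ext F
  simp [not_nonempty_iff_eq_empty]

/-- By Alexander's subbase theorem. The complement `F₀` of all open sets whose hit sets belong to
the cover lies in no such hit set, so it lies in a miss set of some compact `K`, and finitely many
of those open sets cover `K`. -/
theorem compactSpace_fell : CompactSpace (Closeds Y) := by
  refine compactSpace_generateFrom rfl fun P hP hcov => ?_
  let O : Set (Set Y) := {U | IsOpen U ∧ {F : Closeds Y | ((F : Set Y) ∩ U).Nonempty} ∈ P}
  let F₀ : Closeds Y := ⟨(⋃₀ O)ᶜ, (isOpen_sUnion fun U hU => hU.1).isClosed_compl⟩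
  obtain ⟨S, hSP, hS⟩ : F₀ ∈ ⋃₀ P := hcov ▸ mem_univ _
  rcases hP hSP with ⟨K, hK, rfl⟩ | ⟨U, hU, rfl⟩
  · have hKO : K ⊆ ⋃₀ O := fun y hy => by
      by_contra hyO
      exact (hS ▸ ⟨hyO, hy⟩ : y ∈ (∅ : Set Y))
    obtain ⟨T, hTO, hTf, hKT⟩ := hK.elim_finite_subcover_image (b := O) (c := id) (fun U hU => hU.1)
      (by simpa [sUnion_eq_biUnion] using hKO)
    refine ⟨insert {F : Closeds Y | (F : Set Y) ∩ K = ∅}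
      ((fun U => {F : Closeds Y | ((F : Set Y) ∩ U).Nonempty}) '' T), ?_, (hTf.image _).insert _,
      eq_univ_of_forall fun F => ?_⟩
    · rintro _ (rfl | ⟨U, hU, rfl⟩)
      exacts [hSP, (hTO hU).2]
    · rcases ((F : Set Y) ∩ K).eq_empty_or_nonempty with h | ⟨y, hyF, hyK⟩
      · exact ⟨_, mem_insert _ _, h⟩
      · obtain ⟨U, hU, hyU⟩ := mem_iUnion₂.1 (hKT hyK)
        exact ⟨_, mem_insert_of_mem _ ⟨U, hU, rfl⟩, ⟨y, hyF, hyU⟩⟩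
  · obtain ⟨y, hy, hyU⟩ := hS
    exact (hy ⟨U, ⟨hU, hSP⟩, hyU⟩).elim

theorem t2Space_fell [LocallyCompactSpace Y] : T2Space (Closeds Y) := by
  have key : ∀ F G : Closeds Y, ∀ y ∈ F, y ∉ G →
      ∃ U V : Set (Closeds Y), IsOpen U ∧ IsOpen V ∧ F ∈ U ∧ G ∈ V ∧ Disjoint U V := by
    intro F G y hyF hyG
    obtain ⟨K, hK, hKG, hKc⟩ := local_compact_nhds (G.isClosed.isOpen_compl.mem_nhds hyG)
    refine ⟨_, _, isOpen_fell_inter_nonempty isOpen_interior, isOpen_fell_inter_eq_empty hKc,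
      ⟨y, hyF, mem_interior_iff_mem_nhds.2 hK⟩, ?_, ?_⟩
    · exact eq_empty_of_forall_notMem fun z hz => hKG hz.2 hz.1
    · rw [Set.disjoint_left]
      rintro H ⟨z, hz, hzK⟩ hH
      exact (hH ▸ ⟨hz, interior_subset hzK⟩ : z ∈ (∅ : Set Y))
  refine ⟨fun F G hFG => ?_⟩
  by_cases h : ∃ y ∈ F, y ∉ G
  · obtain ⟨y, hyF, hyG⟩ := h
    exact key F G y hyF hyG
  · push Not at h
    obtain ⟨y, hyG, hyF⟩ : ∃ y ∈ G, y ∉ F := by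
      by_contra! h'
      exact hFG (SetLike.ext fun y => ⟨h y, h' y⟩)
    obtain ⟨U, V, hU, hV, hGU, hFV, hd⟩ := key G F y hyG hyF
    exact ⟨V, U, hV, hU, hFV, hGU, hd.symm⟩

theorem secondCountableTopology_fell [T2Space Y] [LocallyCompactSpace Y]
    [SecondCountableTopology Y] : SecondCountableTopology (Closeds Y) := by
  obtain ⟨B, hBc, hBk, hB⟩ := exists_countable_isCompact_nhds Y
  have hb := isBasis_countableBasis Y
  let G : Set (Set (Closeds Y)) :=
    (fun C => {F : Closeds Y | (F : Set Y) ∩ C = ∅}) '' B ∪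
      (fun U => {F : Closeds Y | ((F : Set Y) ∩ U).Nonempty}) '' countableBasis Y
  refine ⟨G, (hBc.image _).union ((countable_countableBasis Y).image _), le_antisymm ?_ ?_⟩
  · refine le_generateFrom ?_
    rintro _ (⟨C, hC, rfl⟩ | ⟨U, hU, rfl⟩)
    · exact isOpen_fell_inter_eq_empty (hBk C hC)
    · exact isOpen_fell_inter_nonempty (hb.isOpen hU)
  · refine le_generateFrom ?_
    let _ := generateFrom G
    rintro _ (⟨K, hK, rfl⟩ | ⟨U, hU, rfl⟩)
    · have : {F : Closeds Y | (F : Set Y) ∩ K = ∅} =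
          ⋃ S ∈ {S : Set (Set Y) | S ⊆ B ∧ S.Finite ∧ K ⊆ ⋃₀ S},
            ⋂ C ∈ S, {F : Closeds Y | (F : Set Y) ∩ C = ∅} := by
        ext F
        simp only [mem_ofPred_eq, mem_iUnion, mem_iInter, exists_prop]
        constructor
        · intro hF
          obtain ⟨S, hSB, hSf, hKS, hSF⟩ := hK.exists_finite_subset_sUnion hB
            F.isClosed.isOpen_compl (fun y hy hyF => (hF ▸ ⟨hyF, hy⟩ : y ∈ (∅ : Set Y)))
          exact ⟨S, ⟨hSB, hSf, hKS⟩, fun C hC =>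
            eq_empty_of_forall_notMem fun y hy => hSF ⟨C, hC, hy.2⟩ hy.1⟩
        · rintro ⟨S, ⟨-, -, hKS⟩, hS⟩
          refine eq_empty_of_forall_notMem fun y hy => ?_
          obtain ⟨C, hC, hyC⟩ := hKS hy.2
          exact (hS C hC ▸ ⟨hy.1, hyC⟩ : y ∈ (∅ : Set Y))
      rw [this]
      exact isOpen_biUnion fun S hS => hS.2.1.isOpen_biInter fun C hC =>
        isOpen_generateFrom_of_mem (Or.inl ⟨C, hS.1 hC, rfl⟩)
    · have : {F : Closeds Y | ((F : Set Y) ∩ U).Nonempty} =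
          ⋃ V ∈ {V | V ∈ countableBasis Y ∧ V ⊆ U},
            {F : Closeds Y | ((F : Set Y) ∩ V).Nonempty} := by
        ext F
        simp only [mem_ofPred_eq, mem_iUnion, exists_prop]
        constructor
        · rintro ⟨y, hyF, hyU⟩
          obtain ⟨V, hV, hyV, hVU⟩ := hb.mem_nhds_iff.1 (hU.mem_nhds hyU)
          exact ⟨V, ⟨hV, hVU⟩, y, hyF, hyV⟩
        · rintro ⟨V, ⟨-, hVU⟩, y, hyF, hyV⟩
          exact ⟨y, hyF, hVU hyV⟩
      rw [this]
      exact isOpen_biUnion fun V hV => isOpen_generateFrom_of_mem (Or.inr ⟨V, hV.1, rfl⟩)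

theorem IsLocallyClosed.isStandardSpace_fell (hY : IsStandardSpace Y) {S : Set (Closeds Y)}
    (hS : IsLocallyClosed S) : IsStandardSpace S := by
  have := hY.secondCountableTopology
  obtain ⟨_, _, _⟩ := hY
  have := compactSpace_fell (Y := Y)
  have := t2Space_fell (Y := Y)
  have := secondCountableTopology_fell (Y := Y)
  exact ⟨hS.locallyCompactSpace, inferInstance, inferInstance⟩

variable {X : Type*} {q : Y → X}

theorem mem_YStar_of_eq_preimage (hq : Function.Surjective q) {F : Closeds Y} {x : X}
    (hF : (F : Set Y) = q ⁻¹' {x}) : F ∈ YStar q := by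
  obtain ⟨y, hy⟩ := hq x
  exact ⟨⟨y, hF ▸ hy⟩, subset_closure ⟨x, hF⟩⟩

variable [TopologicalSpace X]

/-- The non-empty members of the Fell closure of the set of fibres over points of `E`. -/
def singletonFibreClosure (q : Y → X) : Set (Closeds Y) :=
  {F | (F : Set Y).Nonempty ∧
    F ∈ closure {G : Closeds Y | ∃ x ∈ singletonPoints q, (G : Set Y) = q ⁻¹' {x}}}

theorem isLocallyClosed_singletonFibreClosure : IsLocallyClosed (singletonFibreClosure q) := by
  refine ⟨_, _, isOpen_fell_inter_nonempty isOpen_univ, isClosed_closure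
    (s := {G : Closeds Y | ∃ x ∈ singletonPoints q, (G : Set Y) = q ⁻¹' {x}}), ?_⟩
  ext F
  simp [singletonFibreClosure]

theorem isCompact_singletonFibreClosure_inter {K : Set Y} (hK : IsCompact K) :
    IsCompact {F : singletonFibreClosure q | ((F.1 : Set Y) ∩ K).Nonempty} := by
  have := compactSpace_fell (Y := Y)
  rw [IsInducing.subtypeVal.isCompact_iff]
  convert (isClosed_closure (s := {G : Closeds Y | ∃ x ∈ singletonPoints q,
    (G : Set Y) = q ⁻¹' {x}})).inter (isClosed_fell_inter_nonempty hK) |>.isCompact using 1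
  ext F
  constructor
  · rintro ⟨F, hF, rfl⟩
    exact ⟨F.2.2, hF⟩
  · rintro ⟨hF, hFK⟩
    exact ⟨⟨F, hFK.mono inter_subset_left, hF⟩, hFK, rfl⟩

theorem singletonFibreClosure_subset : singletonFibreClosure q ⊆ YStar q := fun _ hF =>
  by
  refine ⟨hF.1, closure_mono ?_ hF.2⟩
  rintro G ⟨x, -, hx⟩
  exact ⟨x, hx⟩

variable [T2Space X]

theorem eq_preimage_of_mem_singletonPoints (hq : IsQuotientMap q) {F : YStar q}
    (hF : qStar q F ∈ singletonPoints q) : (F.1 : Set Y) = q ⁻¹' {qStar q F} := by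
  obtain ⟨-, H, hH⟩ := hF
  let G : Closeds Y := ⟨q ⁻¹' {qStar q F}, isClosed_singleton.preimage hq.continuous⟩
  have hG : G ∈ YStar q := mem_YStar_of_eq_preimage hq.surjective rfl
  obtain ⟨y, hy⟩ := hG.1
  have hGx : qStar q ⟨G, hG⟩ = qStar q F := (qStar_eq hq.continuous ⟨G, hG⟩ hy).trans hy
  have h₁ : F ∈ ({H} : Set (YStar q)) := hH ▸ rfl
  have h₂ : (⟨G, hG⟩ : YStar q) ∈ ({H} : Set (YStar q)) := hH ▸ hGx
  rw [show F = ⟨G, hG⟩ from h₁.trans h₂.symm] at *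
  rw [hGx]
  rfl

/-- If `F` over `x` omits a point `y` of the fibre, take `C ∈ B` around `y` missing `F`; then `x` is
interior to `q '' C`. A fibre close to `F` misses `C` yet lies over a point of `q '' C`, which is
absurd. -/
theorem mem_singletonPoints (hq : IsQuotientMap q) {B : Set (Set Y)}
    (hBk : ∀ C ∈ B, IsCompact C) (hB : ∀ y, ∀ O ∈ 𝓝 y, ∃ C ∈ B, C ∈ 𝓝 y ∧ C ⊆ O) {x : X}
    (hx : x ∈ pointsOfLocalCompactness X) (hxB : ∀ C ∈ B, x ∉ frontier (q '' C)) :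
    x ∈ singletonPoints q := by
  let G : Closeds Y := ⟨q ⁻¹' {x}, isClosed_singleton.preimage hq.continuous⟩
  have hG : G ∈ YStar q := mem_YStar_of_eq_preimage hq.surjective rfl
  refine ⟨hx, ⟨G, hG⟩, Set.ext fun F => ⟨fun hF => ?_, ?_⟩⟩
  · refine Subtype.ext (SetLike.ext fun y => ⟨fun hy => ?_, fun hy => ?_⟩)
    · exact (qStar_eq hq.continuous F hy).symm.trans hF
    · by_contra hyF
      have hyx : q y = x := hy
      obtain ⟨C, hC, hCy, hCF⟩ := hB y _ (F.1.isClosed.isOpen_compl.mem_nhds hyF)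
      have hxC : x ∈ interior (q '' C) := by
        by_contra hn
        exact hxB C hC ⟨subset_closure ⟨y, mem_of_mem_nhds hCy, hyx⟩, hn⟩
      obtain ⟨z, hz⟩ := F.2.1
      obtain ⟨H, ⟨hHC, w, hwH, hw⟩, x', hHx⟩ := mem_closure_iff.1 F.2.2 _
        ((isOpen_fell_inter_eq_empty (hBk C hC)).inter
          (isOpen_fell_inter_nonempty (isOpen_interior.preimage hq.continuous)))
        ⟨eq_empty_of_forall_notMem fun a ha => hCF ha.2 ha.1, z, hz, by
          rw [mem_preimage, ← qStar_eq hq.continuous F hz]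
          exact (show qStar q F = x from hF) ▸ hxC⟩
      obtain ⟨c, hc, hcw⟩ := interior_subset (mem_preimage.1 hw)
      have hwx : q w = x' := by
        have : w ∈ q ⁻¹' {x'} := hHx ▸ hwH
        exact this
      have hcH : c ∈ (H : Set Y) := by
        rw [hHx]
        exact hcw.trans hwx
      exact (hHC ▸ ⟨hcH, hc⟩ : c ∈ (∅ : Set Y))
  · rintro rfl
    obtain ⟨y, hy⟩ := hG.1
    exact (qStar_eq hq.continuous ⟨G, hG⟩ hy).trans hy

theorem pointsOfLocalCompactness_subset_closure_singletonPoints (hY : IsStandardSpace Y)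
    (hq : IsQuotientMap q) : pointsOfLocalCompactness X ⊆ closure (singletonPoints q) := by
  have := hY.secondCountableTopology
  have := hY.t2Space
  obtain ⟨_, _, _⟩ := hY
  obtain ⟨B, hBc, hBk, hB⟩ := exists_countable_isCompact_nhds Y
  refine (pointsOfLocalCompactness_subset_closure
    (S := (fun C => frontier (q '' C)) '' B) (hBc.image _) ?_ ?_).trans (closure_mono ?_)
  · rintro _ ⟨C, -, rfl⟩
    exact isClosed_frontier
  · rintro _ ⟨C, hC, rfl⟩
    exact interior_frontier ((hBk C hC).image hq.continuous).isClosed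
  · rintro x ⟨hx, hxB⟩
    exact mem_singletonPoints hq hBk hB hx fun C hC => hxB _ ⟨C, hC, rfl⟩

/-- The restriction of `q_*` to `singletonFibreClosure q`. -/
noncomputable def singletonFibreMap (q : Y → X) (F : singletonFibreClosure q) : X :=
  qStar q ⟨F.1, singletonFibreClosure_subset F.2⟩

theorem singletonFibreMap_eq (hq : Continuous q) (F : singletonFibreClosure q) {y : Y}
    (hy : y ∈ F.1) : singletonFibreMap q F = q y :=
  qStar_eq hq ⟨F.1, singletonFibreClosure_subset F.2⟩ hy

theorem continuous_singletonFibreMap (hq : Continuous q) : Continuous (singletonFibreMap q) := by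
  refine continuous_def.2 fun W hW => ?_
  convert (isOpen_fell_inter_nonempty (hW.preimage hq)).preimage
    (continuous_subtype_val (p := (· ∈ singletonFibreClosure q))) using 1
  ext F
  constructor
  · intro hF
    obtain ⟨y, hy⟩ := F.2.1
    refine ⟨y, hy, ?_⟩
    rwa [mem_preimage, ← singletonFibreMap_eq hq F hy]
  · rintro ⟨y, hy, hyW⟩
    rwa [mem_preimage, singletonFibreMap_eq hq F hy]

theorem exists_singletonFibreMap_eq (hq : IsQuotientMap q) {x : X} (hx : x ∈ singletonPoints q) :
    ∃ F : singletonFibreClosure q, singletonFibreMap q F = x ∧ (F.1 : Set Y) = q ⁻¹' {x} := by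
  let G : Closeds Y := ⟨q ⁻¹' {x}, isClosed_singleton.preimage hq.continuous⟩
  obtain ⟨y, hy⟩ := hq.surjective x
  let F : singletonFibreClosure q := ⟨G, ⟨y, hy⟩, subset_closure ⟨x, hx, rfl⟩⟩
  exact ⟨F, (singletonFibreMap_eq hq.continuous F hy).trans hy, rfl⟩

theorem closure_subset_image_singletonFibreMap (hq : IsQuotientMap q) {K : Set Y}
    (hK : IsCompact K) : closure (singletonPoints q ∩ q '' K) ⊆
      singletonFibreMap q '' {F | ((F.1 : Set Y) ∩ K).Nonempty} := by
  refine closure_minimal ?_ ((isCompact_singletonFibreClosure_inter hK).image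
    (continuous_singletonFibreMap hq.continuous)).isClosed
  rintro _ ⟨hx, y, hy, rfl⟩
  obtain ⟨F, hF, hFy⟩ := exists_singletonFibreMap_eq hq hx
  exact ⟨F, ⟨y, hFy ▸ rfl, hy⟩, hF⟩

theorem surjective_singletonFibreMap (hq : IsQuotientMap q) (K : CompactExhaustion Y)
    (hE : SequentiallyDense (singletonPoints q)) :
    Function.Surjective (singletonFibreMap q) := fun x => by
  obtain ⟨u, huE, hu⟩ : x ∈ seqClosure (singletonPoints q) := hE ▸ mem_univ x
  obtain ⟨k, hk⟩ := hq.exists_forall_mem_image K hu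
  obtain ⟨F, -, hF⟩ := closure_subset_image_singletonFibreMap hq (K.isCompact k)
    (mem_closure_of_tendsto hu (Eventually.of_forall fun n => ⟨huE n, hk n⟩))
  exact ⟨F, hF⟩

theorem isIrreducibleMap_singletonFibreMap (hq : IsQuotientMap q)
    (hs : Function.Surjective (singletonFibreMap q)) :
    IsIrreducibleMap (singletonFibreMap q) := by
  refine ⟨hs, fun V hV hVX => eq_univ_of_forall fun F => ?_⟩
  obtain ⟨T, hT, rfl⟩ := isClosed_induced_iff.1 hV
  refine closure_minimal ?_ hT F.2.2
  rintro G ⟨x, hx, hG⟩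
  obtain ⟨H, hHT, hHx⟩ : x ∈ singletonFibreMap q '' (Subtype.val ⁻¹' T) := hVX ▸ mem_univ x
  -- Over a point of `E` the full fibre is the only member, so `H = G`.
  have hH := eq_preimage_of_mem_singletonPoints hq
    (F := ⟨H.1, singletonFibreClosure_subset H.2⟩) (by rwa [show qStar q _ = x from hHx])
  rw [show qStar q _ = x from hHx, ← hG] at hH
  exact SetLike.coe_injective hH ▸ hHT

/-- If all diagonal sequences of a double sequence converge to the same point, almost all rows
lie in the image of one member of a compact exhaustion. -/
theorem Topology.IsQuotientMap.exists_forall_forall_mem_image (hq : IsQuotientMap q)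
    (K : CompactExhaustion Y) {z : ℕ → ℕ → X} {x : X}
    (hz : ∀ j : ℕ → ℕ, Tendsto (fun n => z n (j n)) atTop (𝓝 x)) :
    ∃ k N, ∀ n ≥ N, ∀ j, z n j ∈ q '' K k := by
  by_contra! h
  obtain ⟨φ, hφ, hz'⟩ := extraction_forall_of_frequently
    (P := fun k n => ∃ j, z n j ∉ q '' K k) fun k => frequently_atTop.2 (h k)
  choose j hj using hz'
  -- Bad terms are chosen in the rows `φ k`; the index 0 used in the other rows is irrelevant.
  have ht := (hz (Function.extend φ j 0)).comp hφ.tendsto_atTop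
  obtain ⟨k, hk⟩ := hq.exists_forall_mem_image K ht
  have := hk k
  simp only [Function.comp_apply, hφ.injective.extend_apply] at this
  exact hj k this

/-- Property (b) puts almost all rows inside a single `q '' K k`. Their limits then lift to members
meeting `K k`, which form a compact set, so a limit of points of `A` stays in `A`. -/
theorem isQuotientMap_singletonFibreMap [SequentialSpace X] (hq : IsQuotientMap q)
    (K : CompactExhaustion Y) (hE : SequentiallyDense (singletonPoints q))
    (hb : PropertyB (singletonPoints q)) : IsQuotientMap (singletonFibreMap q) := by
  have hc := continuous_singletonFibreMap hq.continuous
  refine isQuotientMap_iff_isClosed.2 ⟨surjective_singletonFibreMap hq K hE,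
    fun A => ⟨fun hA => hA.preimage hc, fun hA => ?_⟩⟩
  refine isSeqClosed_iff_isClosed.1 fun u x huA hu => ?_
  by_contra hxA
  obtain ⟨φ, hφ, hinj⟩ := hu.exists_injective_subseq fun n hn => hxA (hn ▸ huA n)
  obtain ⟨ψ, hψ, z, hzE, hzu, hzx⟩ := hb x _ hinj (hu.comp hφ.tendsto_atTop)
  obtain ⟨k, N, hkN⟩ := hq.exists_forall_forall_mem_image K hzx
  let S : Set (singletonFibreClosure q) := {F | ((F.1 : Set Y) ∩ K k).Nonempty}
  have hS : IsClosed (singletonFibreMap q '' (S ∩ singletonFibreMap q ⁻¹' A)) :=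
    (((isCompact_singletonFibreClosure_inter (K.isCompact k)).inter_right hA).image hc).isClosed
  have hmem : ∀ᶠ n in atTop,
      u (φ (ψ n)) ∈ singletonFibreMap q '' (S ∩ singletonFibreMap q ⁻¹' A) := by
    filter_upwards [eventually_ge_atTop N] with n hn
    obtain ⟨F, hF, hFu⟩ := closure_subset_image_singletonFibreMap hq (K.isCompact k)
      (mem_closure_of_tendsto (hzu n) (Eventually.of_forall fun j => ⟨hzE n j, hkN n hn j⟩))
    exact ⟨F, ⟨hF, by rw [mem_preimage, hFu]; exact huA _⟩, hFu⟩
  obtain ⟨F, ⟨-, hF⟩, rfl⟩ := hS.mem_of_tendsto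
    (hu.comp (hφ.tendsto_atTop.comp hψ.tendsto_atTop)) hmem
  exact hxA hF

theorem isIrreducibleQuotientOfStandard_of_propertyB {Y : Type u} [TopologicalSpace Y]
    {q : Y → X} (hY : IsStandardSpace Y) (hq : IsQuotientMap q)
    (hE : SequentiallyDense (singletonPoints q)) (hb : PropertyB (singletonPoints q)) :
    IsIrreducibleQuotientOfStandard.{u} X := by
  have hZ := isLocallyClosed_singletonFibreClosure.isStandardSpace_fell hY (S :=
    singletonFibreClosure q)
  have := hY.secondCountableTopology
  obtain ⟨_, _, _⟩ := hY
  have := hq.sequentialSpace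
  let K : CompactExhaustion Y := default
  exact ⟨singletonFibreClosure q, inferInstance, singletonFibreMap q, hZ,
    isQuotientMap_singletonFibreMap hq K hE hb,
    isIrreducibleMap_singletonFibreMap hq (surjective_singletonFibreMap hq K hE)⟩

end FellTopology

/-! ### Diagonal sequences -/

section DiagonalCondition

variable {X : Type*} [TopologicalSpace X]

theorem exists_seq_of_mem_closure {E V : Set X} {x : X} [(𝓝 x).IsCountablyGenerated]
    (hx : x ∈ closure E) (hV : V ∈ 𝓝 x) :
    ∃ u : ℕ → X, (∀ n, u n ∈ E ∩ V) ∧ Tendsto u atTop (𝓝 x) := by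
  have : (𝓝[E ∩ V] x).NeBot := by
    rw [nhdsWithin_inter_of_mem' (mem_nhdsWithin_of_mem_nhds hV)]
    exact mem_closure_iff_nhdsWithin_neBot.1 hx
  obtain ⟨u, hu⟩ := exists_seq_tendsto (𝓝[E ∩ V] x)
  obtain ⟨hux, huE⟩ := tendsto_nhdsWithin_iff.1 hu
  obtain ⟨N, hN⟩ := eventually_atTop.1 huE
  exact ⟨fun n => u (n + N), fun n => hN _ (Nat.le_add_left _ _),
    hux.comp (tendsto_add_atTop_nat N)⟩

theorem diagonalConditionAt_of_mem {E O : Set X} (hO : IsOpen O)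
    (hcg : ∀ x ∈ O, (𝓝 x).IsCountablyGenerated) (hE : O ⊆ closure E) {x₀ : X} (hx₀ : x₀ ∈ O) :
    DiagonalConditionAt E x₀ := by
  intro x _ hx
  have := hcg x₀ hx₀
  obtain ⟨V, hV, hVb⟩ := (nhds_basis_opens x₀).exists_antitone_subbasis
  obtain ⟨φ, hφ, hφV⟩ := extraction_forall_of_eventually
    (P := fun i n => x n ∈ V i ∩ O) fun i =>
      hx.eventually (inter_mem ((hV i).2.mem_nhds (hV i).1) (hO.mem_nhds hx₀))
  have hz : ∀ n, ∃ u : ℕ → X, (∀ j, u j ∈ E ∩ V n) ∧ Tendsto u atTop (𝓝 (x (φ n))) := fun n => by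
    have := hcg _ (hφV n).2
    exact exists_seq_of_mem_closure (hE (hφV n).2) ((hV n).2.mem_nhds (hφV n).1)
  choose z hz hzx using hz
  exact ⟨φ, hφ, z, fun n j => (hz n j).1, hzx, fun j => hVb.tendsto fun n => (hz n (j n)).2⟩

theorem sequentiallyDense_of_diagonalConditionAt [T2Space X] {A E : Set X}
    (hA : SequentiallyDense A) (hAE : A ⊆ seqClosure E)
    (h : ∀ x₀ ∉ A, DiagonalConditionAt E x₀) : SequentiallyDense E := by
  refine eq_univ_of_forall fun x => ?_
  by_cases hx : x ∈ A
  · exact hAE hx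
  obtain ⟨u, huA, hu⟩ : x ∈ seqClosure A := hA ▸ mem_univ x
  obtain ⟨φ, hφ, hinj⟩ := hu.exists_injective_subseq fun n hn => hx (hn ▸ huA n)
  obtain ⟨-, -, z, hzE, -, hz⟩ := h x hx _ hinj (hu.comp hφ.tendsto_atTop)
  -- Any diagonal sequence would do.
  exact ⟨fun n => z n 0, fun n => hzE n 0, hz 0⟩

theorem diagonalConditionAt_of_dense_preimage [T2Space X] {Z : Type*} [TopologicalSpace Z]
    (hZ : IsStandardSpace Z) {p : Z → X} (hp : IsQuotientMap p) {E : Set X}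
    (hE : Dense (p ⁻¹' E)) (x₀ : X) : DiagonalConditionAt E x₀ := by
  intro x _ hx
  have := hZ.secondCountableTopology
  obtain ⟨_, _, _⟩ := hZ
  let _ := metrizableSpaceMetric Z
  obtain ⟨k, hk⟩ := hp.exists_forall_mem_image (default : CompactExhaustion Z) hx
  choose w hwk hwx using hk
  obtain ⟨w₀, -, φ, hφ, hw⟩ := (CompactExhaustion.isCompact _ k).tendsto_subseq hwk
  -- The radii tend to 0, so every diagonal choice converges to the limit `w₀` of the `w (φ n)`.
  have hd : ∀ n, ∃ d : ℕ → Z, (∀ j, d j ∈ p ⁻¹' E ∩ Metric.ball (w (φ n)) (1 / (n + 1))) ∧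
      Tendsto d atTop (𝓝 (w (φ n))) := fun n =>
    exists_seq_of_mem_closure (hE _) (Metric.ball_mem_nhds _ Nat.one_div_pos_of_nat)
  choose d hd hdw using hd
  have hc := hp.continuous
  refine ⟨φ, hφ, fun n j => p (d n j), fun n j => (hd n j).1, fun n => ?_, fun j => ?_⟩
  · exact hwx (φ n) ▸ (hc.tendsto _).comp (hdw n)
  · have hw₀ : p w₀ = x₀ := tendsto_nhds_unique_of_eventuallyEq ((hc.tendsto _).comp hw)
      (hx.comp hφ.tendsto_atTop) (Eventually.of_forall fun n => hwx _)
    have : Tendsto (fun n => d n (j n)) atTop (𝓝 w₀) := by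
      refine (tendsto_iff_of_dist ?_).2 hw
      exact squeeze_zero (fun _ => dist_nonneg) (fun n => (hd n (j n)).2.le)
        tendsto_one_div_add_atTop_nhds_zero_nat
    exact hw₀ ▸ (hc.tendsto _).comp this

end DiagonalCondition

/-! ### Irreducible maps and the main equivalence -/

theorem IsIrreducibleMap.dense_preimage {Z X : Type*} [TopologicalSpace Z] [TopologicalSpace X]
    [T2Space X] {p : Z → X} (hirr : IsIrreducibleMap p) (hp : IsQuotientMap p)
    (K : CompactExhaustion Z) {A E : Set X} (hAo : IsOpen A) (hA : SequentiallyDense A)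
    (hAE : A ⊆ seqClosure E) : Dense (p ⁻¹' E) := by
  refine dense_iff_inter_open.2 fun U hU hne => ?_
  obtain ⟨x, hx⟩ := hirr.exists_fibre_subset hU hne
  -- The first fibre need not lie over `A`; a second use of irreducibility finds one in `U` that
  -- does, and only there is `hAE` available.
  obtain ⟨x', hx'⟩ := hirr.exists_fibre_subset (hU.inter (hAo.preimage hp.continuous))
    (hp.nonempty_inter_preimage K hU hx (hA ▸ mem_univ x))
  obtain ⟨z, rfl⟩ := hp.surjective x'
  exact hp.nonempty_inter_preimage K hU (hx'.trans inter_subset_left) (hAE (hx' rfl).2)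

theorem theorem6p5 {Y : Type u} {X : Type v} [TopologicalSpace Y] [TopologicalSpace X]
    [T2Space X] (hY : IsStandardSpace Y) (q : Y → X) (hq : IsQuotientMap q)
    (hL : SequentiallyDense (pointsOfLocalCompactness X)) :
    List.TFAE
      [IsIrreducibleQuotientOfStandard.{w} X,
       SequentiallyDense (singletonPoints q) ∧ PropertyB (singletonPoints q),
       ∀ x₀ : X, x₀ ∉ pointsOfLocalCompactness X →
         DiagonalConditionAt (singletonPoints q) x₀] := by
  have := hY.secondCountableTopology
  have hLE := pointsOfLocalCompactness_subset_closure_singletonPoints hY hq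
  have hLo := isOpen_pointsOfLocalCompactness (X := X)
  have hcg : ∀ x ∈ pointsOfLocalCompactness X, (𝓝 x).IsCountablyGenerated := fun x hx => by
    have := hY.1
    exact hq.isCountablyGenerated_nhds default hx
  have hLseq : pointsOfLocalCompactness X ⊆ seqClosure (singletonPoints q) := fun x hx => by
    have := hcg x hx
    obtain ⟨u, hu, hux⟩ := exists_seq_of_mem_closure (hLE hx) univ_mem
    exact ⟨u, fun n => (hu n).1, hux⟩
  tfae_have 1 → 3 := by
    rintro ⟨Z, _, p, hZ, hp, hirr⟩ x₀ -
    have := hZ.secondCountableTopology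
    have := hZ.1
    exact diagonalConditionAt_of_dense_preimage hZ hp
      (hirr.dense_preimage hp default hLo hL hLseq) x₀
  tfae_have 3 → 2 := fun h => ⟨sequentiallyDense_of_diagonalConditionAt hL hLseq h, fun x₀ => by
    by_cases hx₀ : x₀ ∈ pointsOfLocalCompactness X
    · exact diagonalConditionAt_of_mem hLo hcg hLE hx₀
    · exact h x₀ hx₀⟩
  tfae_have 2 → 1 := fun h =>
    (isIrreducibleQuotientOfStandard_of_propertyB hY hq h.1 h.2).change_universe
  tfae_finish
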